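/- Let $f_0,\dots,f_n$ be real-valued functions that are differentiable on $[a,b]$ ($a\le b$, $n\ge 0$), put $v(t)=(f_0(t),\dots,f_n(t))^T$, and let $(a_0,\dots,a_n)$ be a multivariate normal random vector with mean $m=(m_0,\dots,m_n)^T$ and covariance matrix $C$, where $C$ is positive semidefinite and may be singular. Define $$\mu(t)=\sum_{i=0}^n m_i f_i(t),\quad w(t)=C^{1/2}v(t),\quad \gamma(t)=\frac{w(t)}{\|w(t)\|},\quad m_0(t)=\frac{\mu(t)}{\|w(t)\|},\quad m_1(t)=\frac{m_0'(t)}{\|\gamma'(t)\|},$$ and assume that $w(t)\neq 0$ for all $t\in[a,b]$. Let $\operatorname{erf}(x)=\frac{2}{\sqrt\pi}\int_0^x e^{-u^2}\,du$. Then the number of distinct roots $t\in[a,b]$ of $\sum_{i=0}^n a_i f_i(t)=0$ is a random variable with values in $\{0,1,2,\dots,\infty\}$ (measurable up to a null set), and its expectation is $$\frac1\pi\int_a^b \|\gamma'(t)\|\,e^{-\frac12 m_0(t)^2}\left\{e^{-\frac12 m_1(t)^2}+\sqrt{\frac{\pi}{2}}\;m_1(t)\,\operatorname{erf}\!\left[\frac{m_1(t)}{\sqrt2}\right]\right\}dt$$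 as an equality in $[0,\infty]$. At points with $\gamma'(t)=0$, where $m_1(t)$ is undefined, the integrand (without the factor $\frac1\pi$) is read as its limit as $\|\gamma'(t)\|\to0^+$ with $m_0(t)$ and $m_0'(t)$ held fixed, namely $e^{-\frac12 m_0(t)^2}\sqrt{\pi/2}\,|m_0'(t)|$; this is $0$ whenever $C$ is invertible. Moreover, if $C=I$, so that $\gamma(t)=v(t)/\|v(t)\|$, let $\tilde m_0(t)=\gamma(t)\cdot m$ and $\tilde m_1(t)=\frac{\gamma'(t)}{\|\gamma'(t)\|}\cdot m$ be the components of $m$ in the directions of $\gamma(t)$ and $\gamma'(t)$. Then the density of the real roots on $[a,b]$ is $$\rho(t)=\frac1\pi\|\gamma'(t)\|\,e^{-\frac12 \tilde m_0(t)^2}\left\{e^{-\frac12 \tilde m_1(t)^2}+\sqrt{\frac{\pi}{2}}\;\tilde m_1(t)\,\operatorname{erf}\!\left[\frac{\tilde m_1(t)}{\sqrt2}\right]\right\}$$ (and $\rho(t)=0$ where $\gamma'(t)=0$), that is, for every $[c,d]\subseteq[a,b]$ the expected number of roots in $[c,d]$ equals $\int_c^d\rho(t)\,dt$. -/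

import Mathlib

open MeasureTheory ProbabilityTheory
open scoped ENNReal MatrixOrder

noncomputable section

namespace RandomRoots

/-- The error function `erf x = (2 / √π) ∫₀ˣ exp (-u²) du`. -/
def erf (x : ℝ) : ℝ := 2 / √Real.pi * ∫ u in (0 : ℝ)..x, Real.exp (-u ^ 2)

/-- The curve `v(t) = (f₀(t), …, fₙ(t))` in Euclidean space. -/
def curve {n : ℕ} (f : Fin (n + 1) → ℝ → ℝ) (t : ℝ) : EuclideanSpace ℝ (Fin (n + 1)) :=
  WithLp.toLp 2 (fun i => f i t)

/-- The curve `w(t) = C^{1/2} v(t)`, where `C^{1/2}` is the positive semidefinite square root. -/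
def sqrtCurve {n : ℕ} (C : Matrix (Fin (n + 1)) (Fin (n + 1)) ℝ) (f : Fin (n + 1) → ℝ → ℝ)
    (t : ℝ) : EuclideanSpace ℝ (Fin (n + 1)) :=
  Matrix.toEuclideanCLM (𝕜 := ℝ) (CFC.sqrt C) (curve f t)

/-- The radial projection `t ↦ u(t) / ‖u(t)‖` of a curve `u` to the unit sphere. -/
def unitCurve {n : ℕ} (u : ℝ → EuclideanSpace ℝ (Fin (n + 1))) (t : ℝ) :
    EuclideanSpace ℝ (Fin (n + 1)) :=
  ‖u t‖⁻¹ • u t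

/-- The mean function `μ(t) = m₀ f₀(t) + ⋯ + mₙ fₙ(t)`. -/
def meanFun {n : ℕ} (m : EuclideanSpace ℝ (Fin (n + 1))) (f : Fin (n + 1) → ℝ → ℝ)
    (t : ℝ) : ℝ :=
  ∑ i, m i * f i t

/-- The number (possibly infinite) of `t ∈ [a, b]` with `∑ xᵢ fᵢ(t) = 0`, for a fixed
coefficient vector `x`. -/
def rootCount {n : ℕ} (f : Fin (n + 1) → ℝ → ℝ) (a b : ℝ)
    (x : EuclideanSpace ℝ (Fin (n + 1))) : ℝ≥0∞ :=
  (({t ∈ Set.Icc a b | ∑ i, x i * f i t = 0}.encard : ℕ∞) : ℝ≥0∞)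

/-- `(1/π) s e^{-p²/2} { e^{-q²/2} + √(π/2) q erf (q/√2) }`. -/
def densityFormula (s p q : ℝ) : ℝ :=
  1 / Real.pi * (s * Real.exp (-(1 / 2) * p ^ 2) *
    (Real.exp (-(1 / 2) * q ^ 2) + √(Real.pi / 2) * q * erf (q / √2)))

/-- `γ(t) = w(t) / ‖w(t)‖` with `w(t) = C^{1/2} v(t)`. -/
def gammaC {n : ℕ} (C : Matrix (Fin (n + 1)) (Fin (n + 1)) ℝ) (f : Fin (n + 1) → ℝ → ℝ)
    (t : ℝ) : EuclideanSpace ℝ (Fin (n + 1)) :=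
  unitCurve (sqrtCurve C f) t

/-- `m₀(t) = μ(t) / ‖w(t)‖`. -/
def mZero {n : ℕ} (m : EuclideanSpace ℝ (Fin (n + 1)))
    (C : Matrix (Fin (n + 1)) (Fin (n + 1)) ℝ) (f : Fin (n + 1) → ℝ → ℝ) (t : ℝ) : ℝ :=
  meanFun m f t / ‖sqrtCurve C f t‖

/-- `m₁(t) = m₀'(t) / ‖γ'(t)‖`. -/
def mOne {n : ℕ} (m : EuclideanSpace ℝ (Fin (n + 1)))
    (C : Matrix (Fin (n + 1)) (Fin (n + 1)) ℝ) (f : Fin (n + 1) → ℝ → ℝ) (t : ℝ) : ℝ :=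
  deriv (mZero m C f) t / ‖deriv (gammaC C f) t‖

open Classical in
/-- The density of real roots for mean `m` and covariance matrix `C`. Where `γ'(t) = 0`, the
quotient `m₁(t)` is undefined, and the formula is read as the limit of
`(1/π) s e^{-m₀²/2} { e^{-q²/2} + √(π/2) q erf (q/√2) }`, `q = m₀'/s`, as `s → 0+`, namely
`(1/π) e^{-m₀²/2} √(π/2) |m₀'|`. This is `0` if also `m₀'(t) = 0`, which is always
the case when `C` is invertible. -/
def rootDensity {n : ℕ} (m : EuclideanSpace ℝ (Fin (n + 1)))
    (C : Matrix (Fin (n + 1)) (Fin (n + 1)) ℝ) (f : Fin (n + 1) → ℝ → ℝ) (t : ℝ) : ℝ :=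
  if deriv (gammaC C f) t = 0 then
    1 / Real.pi * (Real.exp (-(1 / 2) * mZero m C f t ^ 2) *
      (√(Real.pi / 2) * |deriv (mZero m C f) t|))
  else
    densityFormula ‖deriv (gammaC C f) t‖ (mZero m C f t) (mOne m C f t)

/-- The density of real roots for mean `m` and identity covariance matrix: here
`γ(t) = v(t) / ‖v(t)‖`, and the numbers `m₀(t)`, `m₁(t)` are the components of `m` in the
directions of `γ(t)` and `γ'(t)`. (Where `γ'(t) = 0` the value is `0`.) -/
def rootDensityId {n : ℕ} (m : EuclideanSpace ℝ (Fin (n + 1))) (f : Fin (n + 1) → ℝ → ℝ)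
    (t : ℝ) : ℝ :=
  densityFormula ‖deriv (unitCurve (curve f)) t‖
    (inner ℝ (unitCurve (curve f) t) m)
    (inner ℝ (‖deriv (unitCurve (curve f)) t‖⁻¹ • deriv (unitCurve (curve f)) t) m)

end RandomRoots

end

namespace RandomRoots

/-! Write the coefficient vector as `m + C^{1/2} z` with `z` standard Gaussian. Since `C^{1/2}` is
self-adjoint and `w(t) ≠ 0`, dividing by `‖w(t)‖` turns the equation into `m₀(t) + ⟪γ(t), z⟫ = 0`
with `γ` on the unit sphere. Invertibility of `C` plays no role.

The count comes from the area formula in one variable. Where `⟪e, γ⟫ ≠ 0` for a fixed unit vector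
`e`, split `z = r + s e` with `s` an independent standard normal. For fixed `r` the roots are the
solutions of `g(t) = s` for an explicit `g`, so their expected number is `∫ |g'| φ(g)`, where `φ` is
the standard normal density (`lintegral_encard_fiber`). The formula needs differentiability only,
not continuity of `g'`.

Averaging over `r` is a Gaussian computation (`lintegral_chart`): `g` and `g'` are affine in `z`,
and weighting by `φ(g)` leaves `g'` Gaussian up to a constant factor
(`lintegral_mul_gaussianPDFReal`). The choice of `e` drops out, and what remains is `φ(m₀)` times
the first absolute moment of a normal variable with mean `m₀'` and standard deviation `‖γ'‖`, the
source of the `erf` term. Finitely many directions `e` cover `[a, b]`, and the counts on the pieces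
add up (`expected_zeros_of_continuous`). -/

/-! ### The area formula in one variable -/

lemma encard_iUnion_eq_tsum {α ι : Type*} [Countable ι] (T : ι → Set α)
    (hT : Pairwise (Function.onFun Disjoint T)) :
    (((⋃ i, T i).encard : ℕ∞) : ℝ≥0∞) = ∑' i, (((T i).encard : ℕ∞) : ℝ≥0∞) := by
  -- With every set measurable, cardinality is the counting measure, which is countably additive.
  let _ : MeasurableSpace α := ⊤
  have h : ∀ s : Set α, Measure.count s = ((s.encard : ℕ∞) : ℝ≥0∞) :=
    fun s => Measure.count_apply trivial
  simp_rw [← h]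
  exact measure_iUnion hT fun _ => trivial

lemma encard_fiber_eq_indicator {S : Set ℝ} {g : ℝ → ℝ} (hg : Set.InjOn g S) (s : ℝ) :
    (({t ∈ S | g t = s}.encard : ℕ∞) : ℝ≥0∞) = (g '' S).indicator 1 s := by
  by_cases hs : s ∈ g '' S
  · obtain ⟨t, ht, rfl⟩ := hs
    have : {x ∈ S | g x = g t} = {t} := by
      ext x
      simp only [Set.mem_ofPred_eq, Set.mem_singleton_iff]
      exact ⟨fun h => hg h.1 ht h.2, by rintro rfl; exact ⟨ht, rfl⟩⟩
    rw [this, Set.indicator_of_mem (Set.mem_image_of_mem g ht)]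
    simp
  · have : {x ∈ S | g x = s} = ∅ := by
      ext x
      simp only [Set.mem_ofPred_eq, Set.mem_empty_iff_false, iff_false]
      exact fun h => hs ⟨x, h.1, h.2⟩
    rw [this, Set.indicator_of_notMem hs]
    simp

/-- The area formula on a set where the derivative does not vanish. -/
lemma lintegral_encard_fiber_of_ne_zero {B : Set ℝ} (hB : MeasurableSet B) {g g' : ℝ → ℝ}
    (hg : ∀ t ∈ B, HasDerivWithinAt g (g' t) B t) (hne : ∀ t ∈ B, g' t ≠ 0)
    {h : ℝ → ℝ≥0∞} (hh : Measurable h) :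
    ∫⁻ s, (({t ∈ B | g t = s}.encard : ℕ∞) : ℝ≥0∞) * h s =
      ∫⁻ t in B, ENNReal.ofReal |g' t| * h (g t) := by
  rcases B.eq_empty_or_nonempty with rfl | hBne
  · simp
  obtain ⟨T, A, hTd, hTm, hBT, hTa, hTA⟩ :=
    exists_partition_approximatesLinearOn_of_hasFDerivWithinAt g B
      (fun t => ContinuousLinearMap.toSpanSingleton ℝ (g' t))
      (fun t ht => (hg t ht).hasFDerivWithinAt)
      -- An error below half the slope forces injectivity on each piece. The value `1` only keeps
      -- the tolerance nonzero; it is never used, since the slopes that occur are values of `g'` on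
      -- `B`.
      (fun A => if A 1 = 0 then 1 else ‖A 1‖₊ / 2) (fun A => by
        split_ifs with h0
        · simp
        · simpa using h0)
  have hinj : ∀ n, Set.InjOn g (B ∩ T n) := by
    intro n x hx y hy hxy
    obtain ⟨z, hz, hAz⟩ := hTA hBne n
    have hA1 : A n 1 = g' z := by rw [hAz]; simp
    have hA0 : A n 1 ≠ 0 := hA1 ▸ hne z hz
    have happ := hTa n x hx y hy
    have hlin : A n (x - y) = (x - y) * A n 1 := by
      rw [← smul_eq_mul, ← map_smul]; simp
    rw [hxy, sub_self, zero_sub, norm_neg, hlin, norm_mul] at happ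
    simp only [hA0, if_false, NNReal.coe_div, coe_nnnorm, NNReal.coe_ofNat] at happ
    have hpos : 0 < ‖A n 1‖ := norm_pos_iff.2 hA0
    have : ‖x - y‖ ≤ 0 := by nlinarith [norm_nonneg (x - y)]
    exact sub_eq_zero.1 (norm_le_zero_iff.1 this)
  have hSm : ∀ n, MeasurableSet (B ∩ T n) := fun n => hB.inter (hTm n)
  have hSd : Pairwise (Function.onFun Disjoint fun n => B ∩ T n) := fun i j hij =>
    (hTd hij).mono Set.inter_subset_right Set.inter_subset_right
  have hder : ∀ n, ∀ t ∈ B ∩ T n, HasDerivWithinAt g (g' t) (B ∩ T n) t :=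
    fun n t ht => (hg t ht.1).mono Set.inter_subset_left
  have hBU : B = ⋃ n, B ∩ T n := by
    rw [← Set.inter_iUnion, Set.inter_eq_left.2 hBT]
  have himg : ∀ n, MeasurableSet (g '' (B ∩ T n)) := fun n =>
    measurable_image_of_fderivWithin (hSm n) (fun t ht => (hder n t ht).hasFDerivWithinAt)
      (hinj n)
  have hcount : ∀ s, (({t ∈ B | g t = s}.encard : ℕ∞) : ℝ≥0∞) =
      ∑' n, (g '' (B ∩ T n)).indicator 1 s := by
    intro s
    simp_rw [← encard_fiber_eq_indicator (hinj _)]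
    rw [← encard_iUnion_eq_tsum]
    · congr 2
      ext t
      simp only [Set.mem_ofPred_eq, Set.mem_iUnion]
      constructor
      · rintro ⟨h1, h2⟩
        obtain ⟨n, hn⟩ := Set.mem_iUnion.1 (hBU ▸ h1)
        exact ⟨n, hn, h2⟩
      · rintro ⟨n, hn, h2⟩
        exact ⟨hn.1, h2⟩
    · exact fun i j hij => (hSd hij).mono (Set.sep_subset _ _) (Set.sep_subset _ _)
  simp_rw [hcount, ← ENNReal.tsum_mul_right]
  rw [lintegral_tsum (f := fun n s => (g '' (B ∩ T n)).indicator 1 s * h s)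
    fun n => ((measurable_one.indicator (himg n)).mul hh).aemeasurable]
  conv_rhs => rw [hBU]
  rw [lintegral_iUnion hSm hSd]
  congr 1
  ext n
  rw [← lintegral_image_eq_lintegral_abs_deriv_mul (hSm n) (hder n) (hinj n),
    ← lintegral_indicator (himg n)]
  congr 1
  ext s
  by_cases hs : s ∈ g '' (B ∩ T n) <;> simp [hs]

/-- The area formula for a function of one real variable, differentiable on a measurable set. -/
theorem lintegral_encard_fiber {B : Set ℝ} (hB : MeasurableSet B) {g g' : ℝ → ℝ}
    (hg : ∀ t ∈ B, HasDerivWithinAt g (g' t) B t) (hm : Measurable g')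
    {h : ℝ → ℝ≥0∞} (hh : Measurable h) :
    ∫⁻ s, (({t ∈ B | g t = s}.encard : ℕ∞) : ℝ≥0∞) * h s =
      ∫⁻ t in B, ENNReal.ofReal |g' t| * h (g t) := by
  have hZ : MeasurableSet {t | g' t = 0} := hm (measurableSet_singleton 0)
  -- Critical points count for nothing on either side: their image is null, and the weight `|g'|`
  -- vanishes on them.
  have hnull : volume (g '' (B ∩ {t | g' t = 0})) = 0 :=
    addHaar_image_eq_zero_of_det_fderivWithin_eq_zero volume
      (fun t ht => ((hg t ht.1).mono Set.inter_subset_left).hasFDerivWithinAt)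
      (fun t ht => by
        have h0 : g' t = 0 := ht.2
        simp [h0])
  have hrhs : ∫⁻ t in B, ENNReal.ofReal |g' t| * h (g t) =
      ∫⁻ t in B \ {t | g' t = 0}, ENNReal.ofReal |g' t| * h (g t) := by
    rw [← lintegral_inter_add_sdiff _ B hZ, setLIntegral_congr_fun (hB.inter hZ)
      (g := fun _ => 0) (fun t ht => by
        have h0 : g' t = 0 := ht.2
        simp [h0])]
    simp
  rw [hrhs, ← lintegral_encard_fiber_of_ne_zero (hB.diff hZ)
    (fun t ht => (hg t ht.1).mono Set.sdiff_subset) (fun t ht => ht.2) hh]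
  refine lintegral_congr_ae ?_
  filter_upwards [measure_eq_zero_iff_ae_notMem.1 hnull] with s hs
  congr 4
  ext t
  simp only [Set.mem_ofPred_eq, Set.mem_sdiff]
  exact ⟨fun ⟨h1, h2⟩ => ⟨⟨h1, fun h0 => hs ⟨t, ⟨h1, h0⟩, h2⟩⟩, h2⟩, fun ⟨h1, h2⟩ => ⟨h1.1, h2⟩⟩

/-! ### Measurability of the number of zeros -/

/-- The projection of a closed set along a compact factor is closed. -/
lemma measurableSet_exists_zero {X : Type*} [TopologicalSpace X] [MeasurableSpace X]
    [OpensMeasurableSpace X] {F : ℝ → X → ℝ} (hF : Continuous (Function.uncurry F)) {ι : Type*}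
    {K : Set (ι → ℝ)} (hK : IsCompact K) :
    MeasurableSet {z | ∃ t ∈ K, ∀ i, F (t i) z = 0} := by
  have : CompactSpace K := isCompact_iff_compactSpace.1 hK
  have hcl : IsClosed {y : K × X | ∀ i, F (y.1.1 i) y.2 = 0} := by
    simp only [Set.ofPred_forall]
    refine isClosed_iInter fun i => isClosed_eq ?_ continuous_const
    exact hF.comp ((((continuous_apply i).comp continuous_subtype_val).comp continuous_fst).prodMk
      continuous_snd : Continuous fun y : K × X => (y.1.1 i, y.2))
  have h2 := isClosedMap_snd_of_compactSpace (X := K) (Y := X) _ hcl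
  convert h2.measurableSet using 1
  ext z
  simp only [Set.mem_ofPred_eq, Set.mem_image, Prod.exists, exists_eq_right,
    Subtype.exists, exists_prop]

lemma natCast_le_encard_iff {α : Type*} (T : Set α) (k : ℕ) :
    (k : ℕ∞) ≤ T.encard ↔ ∃ t : Fin k → α, Function.Injective t ∧ ∀ i, t i ∈ T := by
  constructor
  · intro h
    obtain ⟨S, hST, hS⟩ := Set.exists_subset_encard_eq h
    have hfin : S.Finite := Set.finite_of_encard_eq_coe hS
    have hc : S.ncard = k := by rw [Set.ncard, hS]; simp
    have : Fintype S := hfin.fintype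
    have e : Fin k ≃ S := (Fintype.equivFinOfCardEq (by
      rw [← hc, Set.ncard_eq_toFinset_card', Set.toFinset_card])).symm
    exact ⟨fun i => e i, Subtype.val_injective.comp e.injective, fun i => hST (e i).2⟩
  · rintro ⟨t, ht, hT⟩
    have : (Set.range t).encard = k := by
      rw [← Set.image_univ, ht.encard_image, Set.encard_univ]; simp
    rw [← this]
    exact Set.encard_le_encard (Set.range_subset_iff.2 hT)

lemma measurable_toENNReal_of_le {X : Type*} [MeasurableSpace X] {N : X → ℕ∞}
    (h : ∀ k : ℕ, MeasurableSet {z | (k : ℕ∞) ≤ N z}) :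
    Measurable fun z => ((N z : ℕ∞) : ℝ≥0∞) := by
  -- Layer-cake sum: `N` is the number of `k` with `k + 1 ≤ N`, also when `N = ⊤`.
  have key : ∀ z, ((N z : ℕ∞) : ℝ≥0∞) =
      ∑' k : ℕ, {z | ((k + 1 : ℕ) : ℕ∞) ≤ N z}.indicator (1 : X → ℝ≥0∞) z := by
    intro z
    have h1 : ∀ k : ℕ, {z | ((k + 1 : ℕ) : ℕ∞) ≤ N z}.indicator (1 : X → ℝ≥0∞) z =
        {k : ℕ | ((k + 1 : ℕ) : ℕ∞) ≤ N z}.indicator 1 k := fun k => rfl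
    simp_rw [h1]
    rw [← tsum_subtype]
    simp only [Pi.one_apply, ENNReal.tsum_set_one]
    congr 1
    induction hN : N z using ENat.recTopCoe with
    | top => simp [Set.encard_univ]
    | coe n =>
      have : {k : ℕ | ((k + 1 : ℕ) : ℕ∞) ≤ (n : ℕ∞)} = (Finset.range n : Set ℕ) := by
        ext k; simp only [Set.mem_ofPred_eq, Nat.cast_le, Finset.coe_range, Set.mem_Iio]; omega
      rw [this, Set.encard_coe_eq_coe_finsetCard]; simp
  simp_rw [key]
  exact Measurable.tsum fun k => measurable_one.indicator (h (k + 1))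

/-- The number of zeros of a jointly continuous family on a countable union of compact sets
depends measurably on the parameter. -/
theorem measurable_encard_zeros {X : Type*} [TopologicalSpace X] [MeasurableSpace X]
    [OpensMeasurableSpace X] {F : ℝ → X → ℝ} (hF : Continuous (Function.uncurry F))
    {B : Set ℝ} {K : ℕ → Set ℝ} (hK : ∀ k, IsCompact (K k)) (hB : B = ⋃ k, K k) :
    Measurable fun z => (({t ∈ B | F t z = 0}.encard : ℕ∞) : ℝ≥0∞) := by
  refine measurable_toENNReal_of_le fun k => ?_
  -- Distinctness of `k` zeros is not a closed condition; it is exhausted by the closed conditions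
  -- that all gaps are at least `1 / (r + 1)`.
  let Q : ℕ → Set (Fin k → ℝ) := fun r =>
    {t | ∀ i j, i ≠ j → 1 / ((r : ℝ) + 1) ≤ |t i - t j|}
  have hQ : ∀ r, IsClosed (Q r) := fun r => by
    simp only [Q, Set.ofPred_forall]
    refine isClosed_iInter fun i => isClosed_iInter fun j => isClosed_iInter fun _ => ?_
    exact isClosed_le continuous_const (by fun_prop)
  have hset : {z | (k : ℕ∞) ≤ {t ∈ B | F t z = 0}.encard} =
      ⋃ (l : Fin k → ℕ) (r : ℕ),
        {z | ∃ t ∈ Set.univ.pi (fun i => K (l i)) ∩ Q r, ∀ i, F (t i) z = 0} := by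
    ext z
    simp only [Set.mem_ofPred_eq, natCast_le_encard_iff, Set.mem_iUnion]
    constructor
    · rintro ⟨t, ht, hT⟩
      have h1 : ∀ i, ∃ l, t i ∈ K l := fun i => Set.mem_iUnion.1 (hB ▸ (hT i).1)
      choose l hl using h1
      have h2 : ∃ r : ℕ, ∀ i j, i ≠ j → 1 / ((r : ℝ) + 1) ≤ |t i - t j| := by
        have h3 : ∀ p : Fin k × Fin k, ∀ᶠ r : ℕ in Filter.atTop,
            p.1 ≠ p.2 → 1 / ((r : ℝ) + 1) ≤ |t p.1 - t p.2| := by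
          intro p
          by_cases hp : p.1 = p.2
          · simp [hp]
          · have hpos : 0 < |t p.1 - t p.2| := abs_pos.2 (sub_ne_zero.2 (ht.ne hp))
            filter_upwards [(tendsto_one_div_add_atTop_nhds_zero_nat (𝕜 := ℝ)).eventually
              (ge_mem_nhds hpos)] with r hr _ using hr
        obtain ⟨r, hr⟩ := (Filter.eventually_all.2 h3).exists
        exact ⟨r, fun i j => hr (i, j)⟩
      obtain ⟨r, hr⟩ := h2
      exact ⟨l, r, t, ⟨fun i _ => hl i, hr⟩, fun i => (hT i).2⟩
    · rintro ⟨l, r, t, ⟨h1, h2⟩, h3⟩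
      refine ⟨t, fun i j hij => ?_, fun i => ⟨hB ▸ Set.mem_iUnion.2 ⟨l i, h1 i trivial⟩, h3 i⟩⟩
      by_contra hne
      have := h2 i j hne
      rw [hij, sub_self, abs_zero] at this
      have : (0 : ℝ) < 1 / ((r : ℝ) + 1) := by positivity
      linarith
  rw [hset]
  exact MeasurableSet.iUnion fun l => MeasurableSet.iUnion fun r =>
    measurableSet_exists_zero hF
      ((isCompact_univ_pi fun i => hK (l i)).inter_right (hQ r))

/-! ### Gaussian vectors: resampling and tilting -/

/-- Completing the square in `s`. Up to the factor `(2π)^{-1/2}`, this is the characteristic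
function at `u` of the tilted law in `lintegral_mul_gaussianPDFReal`. -/
lemma integral_exp_mul_exp_gaussianReal {E : Type*} [NormedAddCommGroup E]
    [InnerProductSpace ℝ E] (p q : E) (c u : ℝ) :
    ∫ s : ℝ, Complex.exp (s * c * Complex.I) *
        Complex.exp (-‖u • p + s • q‖ ^ 2 / 2) ∂gaussianReal 0 1 =
      ((√(1 + ‖q‖ ^ 2))⁻¹ * Real.exp (-c ^ 2 / (2 * (1 + ‖q‖ ^ 2))) : ℝ) *
      Complex.exp (u * (-c * inner ℝ p q / (1 + ‖q‖ ^ 2) : ℝ) * Complex.I -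
        (‖p‖ ^ 2 - inner ℝ p q ^ 2 / (1 + ‖q‖ ^ 2) : ℝ) * u ^ 2 / 2) := by
  set k : ℝ := 1 + ‖q‖ ^ 2 with hk
  have hk0 : 0 < k := by positivity
  have hkC : (k : ℂ) ≠ 0 := by exact_mod_cast hk0.ne'
  rw [integral_gaussianReal_eq_integral_smul one_ne_zero]
  have h1 : ∀ s : ℝ, gaussianPDFReal 0 1 s • (Complex.exp (s * c * Complex.I) *
        Complex.exp (-‖u • p + s • q‖ ^ 2 / 2)) = ((√(2 * Real.pi))⁻¹ : ℝ) *
      Complex.exp (((-(k / 2) : ℝ) : ℂ) * s ^ 2 + (c * Complex.I - u * (inner ℝ p q : ℝ)) * s +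
        (-(u ^ 2 * ‖p‖ ^ 2 / 2) : ℝ)) := by
    intro s
    have hn : ‖u • p + s • q‖ ^ 2 = u ^ 2 * ‖p‖ ^ 2 + 2 * (u * s * inner ℝ p q) +
        s ^ 2 * ‖q‖ ^ 2 := by
      rw [norm_add_sq_real, inner_smul_left, inner_smul_right, norm_smul, norm_smul, mul_pow,
        mul_pow, Real.norm_eq_abs, Real.norm_eq_abs, sq_abs, sq_abs]
      simp
      ring
    have hn' : ((‖u • p + s • q‖ : ℝ) : ℂ) ^ 2 = u ^ 2 * ‖p‖ ^ 2 +
        2 * (u * s * (inner ℝ p q : ℝ)) + s ^ 2 * ‖q‖ ^ 2 := by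
      exact_mod_cast hn
    rw [hn', gaussianPDFReal_def, Complex.real_smul]
    push_cast
    rw [mul_assoc, ← Complex.exp_add, ← Complex.exp_add]
    congr 1
    · simp
    · congr 1
      rw [hk]
      push_cast
      simp
      ring
  simp_rw [h1]
  rw [integral_const_mul, integral_cexp_quadratic (by
    rw [Complex.ofReal_re]; linarith)]
  have hpow : ((Real.pi : ℂ) / -((-(k / 2) : ℝ) : ℂ)) ^ (1 / 2 : ℂ) =
      ((√(2 * Real.pi) * (√k)⁻¹ : ℝ) : ℂ) := by
    rw [show ((Real.pi : ℂ) / -((-(k / 2) : ℝ) : ℂ)) = ((2 * Real.pi / k : ℝ) : ℂ) by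
      push_cast; field_simp, show (1 / 2 : ℂ) = ((1 / 2 : ℝ) : ℂ) by push_cast; ring,
      ← Complex.ofReal_cpow (by positivity), ← Real.sqrt_eq_rpow, Real.sqrt_div (by positivity)]
    rfl
  have hpi : √(2 * Real.pi) ≠ 0 := by positivity
  rw [hpow, ← mul_assoc, ← Complex.ofReal_mul, inv_mul_cancel_left₀ hpi, Complex.ofReal_mul,
    mul_assoc, Complex.ofReal_exp, ← Complex.exp_add]
  congr 2
  push_cast
  field_simp
  ring_nf
  simp only [Complex.I_sq]
  ring

section Gaussian

variable {E : Type*} [NormedAddCommGroup E] [InnerProductSpace ℝ E] [FiniteDimensional ℝ E]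
  [MeasurableSpace E] [BorelSpace E]

/-- Replacing the component in a unit direction of a standard Gaussian vector by an independent
standard Gaussian variable does not change the law. -/
theorem map_resample_stdGaussian {e : E} (he : ‖e‖ = 1) :
    ((stdGaussian E).prod (gaussianReal 0 1)).map
      (fun y => y.1 - inner ℝ e y.1 • e + y.2 • e) = stdGaussian E := by
  have hmeas : Measurable (fun y : E × ℝ => y.1 - inner ℝ e y.1 • e + y.2 • e) := by fun_prop
  have : IsProbabilityMeasure (((stdGaussian E).prod (gaussianReal 0 1)).map
      (fun y => y.1 - inner ℝ e y.1 • e + y.2 • e)) :=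
    Measure.isProbabilityMeasure_map hmeas.aemeasurable
  refine Measure.ext_of_charFun (funext fun u => ?_)
  rw [charFun_apply, integral_map hmeas.aemeasurable (by fun_prop)]
  -- By independence the characteristic function factors into the part of `u` orthogonal to `e` and
  -- the part along `e`; Pythagoras recombines them.
  have hsplit : ∀ y : E × ℝ,
      Complex.exp ((inner ℝ (y.1 - inner ℝ e y.1 • e + y.2 • e) u : ℝ) * Complex.I) =
      Complex.exp ((inner ℝ y.1 (u - inner ℝ e u • e) : ℝ) * Complex.I) *
        Complex.exp ((inner ℝ e u : ℝ) * (y.2 : ℝ) * Complex.I) := by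
    intro y
    rw [← Complex.exp_add]
    congr 1
    simp only [inner_add_left, inner_sub_left, inner_smul_left, inner_sub_right,
      inner_smul_right, RCLike.conj_to_real]
    rw [real_inner_comm e y.1]
    push_cast
    ring
  simp_rw [hsplit]
  rw [integral_prod_mul (fun z : E => Complex.exp ((inner ℝ z (u - inner ℝ e u • e) : ℝ) *
    Complex.I)) (fun s : ℝ => Complex.exp ((inner ℝ e u : ℝ) * (s : ℝ) * Complex.I)),
    ← charFun_apply, ← charFun_apply_real, charFun_stdGaussian, charFun_stdGaussian,
    charFun_gaussianReal, ← Complex.exp_add]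
  congr 1
  have hn : ‖u - inner ℝ e u • e‖ ^ 2 = ‖u‖ ^ 2 - inner ℝ e u ^ 2 := by
    rw [norm_sub_sq_real, inner_smul_right, norm_smul, he, real_inner_comm e u, mul_one,
      Real.norm_eq_abs, sq_abs]
    ring
  have hn' : ((‖u - inner ℝ e u • e‖ : ℝ) : ℂ) ^ 2 = (‖u‖ : ℂ) ^ 2 - (inner ℝ e u : ℝ) ^ 2 := by
    exact_mod_cast hn
  rw [hn']
  simp
  ring

/-- The standard Gaussian is its own Fourier transform up to a constant. This turns a Gaussian
weight into an average of exponentials, which can be integrated against `stdGaussian`. -/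
lemma gaussianPDFReal_eq_charFun (x : ℝ) :
    ((gaussianPDFReal 0 1 x : ℝ) : ℂ) =
      ((√(2 * Real.pi))⁻¹ : ℝ) * ∫ s : ℝ, Complex.exp (x * s * Complex.I) ∂gaussianReal 0 1 := by
  rw [← charFun_apply_real, charFun_gaussianReal, gaussianPDFReal_def]
  push_cast
  simp
  exact Or.inl (by ring_nf)

lemma integral_exp_mul_gaussianPDFReal (p q : E) (c u : ℝ) :
    ∫ z, ((gaussianPDFReal 0 1 (c + inner ℝ q z) : ℝ) : ℂ) *
        Complex.exp (u * (inner ℝ p z : ℝ) * Complex.I) ∂stdGaussian E =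
      ((√(2 * Real.pi))⁻¹ : ℝ) * ∫ s : ℝ, Complex.exp (s * c * Complex.I) *
        Complex.exp (-‖u • p + s • q‖ ^ 2 / 2) ∂gaussianReal 0 1 := by
  have h1 : ∀ z, ((gaussianPDFReal 0 1 (c + inner ℝ q z) : ℝ) : ℂ) *
      Complex.exp (u * (inner ℝ p z : ℝ) * Complex.I) =
      ((√(2 * Real.pi))⁻¹ : ℝ) * ∫ s : ℝ, Complex.exp (s * c * Complex.I) *
        Complex.exp ((inner ℝ z (u • p + s • q) : ℝ) * Complex.I) ∂gaussianReal 0 1 := by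
    intro z
    rw [gaussianPDFReal_eq_charFun, mul_assoc, ← integral_mul_const]
    congr 2
    ext s
    rw [← Complex.exp_add, ← Complex.exp_add, inner_add_right, inner_smul_right,
      inner_smul_right, real_inner_comm p z, real_inner_comm q z]
    push_cast
    ring_nf
  simp_rw [h1]
  rw [integral_const_mul, integral_integral_swap]
  · congr 2
    ext s
    rw [integral_const_mul, ← charFun_apply, charFun_stdGaussian]
  · refine Integrable.of_bound (by fun_prop) 1 (Filter.Eventually.of_forall fun y => ?_)
    simp only [Function.uncurry]
    rw [norm_mul, Complex.norm_exp_ofReal_mul_I, mul_one,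
      show ((y.2 : ℂ) * (c : ℂ) * Complex.I) = ((y.2 * c : ℝ) : ℂ) * Complex.I by push_cast; ring,
      Complex.norm_exp_ofReal_mul_I]

/-- The law of a linear functional of a standard Gaussian vector, tilted by a Gaussian density in
another linear functional. -/
theorem lintegral_mul_gaussianPDFReal (p q : E) (c : ℝ) {h : ℝ → ℝ≥0∞} (hh : Measurable h) :
    ∫⁻ z, h (inner ℝ p z) * ENNReal.ofReal (gaussianPDFReal 0 1 (c + inner ℝ q z))
        ∂stdGaussian E =
      ENNReal.ofReal ((√(2 * Real.pi))⁻¹ *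
        ((√(1 + ‖q‖ ^ 2))⁻¹ * Real.exp (-c ^ 2 / (2 * (1 + ‖q‖ ^ 2))))) *
      ∫⁻ x, h x ∂gaussianReal (-c * inner ℝ p q / (1 + ‖q‖ ^ 2))
        (‖p‖ ^ 2 - inner ℝ p q ^ 2 / (1 + ‖q‖ ^ 2)).toNNReal := by
  have hd : Measurable fun z : E => ENNReal.ofReal (gaussianPDFReal 0 1 (c + inner ℝ q z)) := by
    fun_prop
  set K : ℝ := (√(2 * Real.pi))⁻¹ *
        ((√(1 + ‖q‖ ^ 2))⁻¹ * Real.exp (-c ^ 2 / (2 * (1 + ‖q‖ ^ 2)))) with hK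
  have hK0 : 0 ≤ K := by positivity
  have hv : 0 ≤ ‖p‖ ^ 2 - inner ℝ p q ^ 2 / (1 + ‖q‖ ^ 2) := by
    rw [sub_nonneg, div_le_iff₀ (by positivity)]
    have h1 := abs_real_inner_le_norm p q
    have h2 : inner ℝ p q ^ 2 ≤ (‖p‖ * ‖q‖) ^ 2 := by
      rw [← sq_abs]; gcongr
    nlinarith [sq_nonneg ‖p‖]
  -- It suffices to identify the tilted law as a measure. Its density is bounded, so it is finite
  -- and determined by its characteristic function.
  set μ₁ : Measure ℝ := ((stdGaussian E).withDensity
    fun z => ENNReal.ofReal (gaussianPDFReal 0 1 (c + inner ℝ q z))).map (fun z => inner ℝ p z)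
  set μ₂ : Measure ℝ := ENNReal.ofReal K • gaussianReal (-c * inner ℝ p q / (1 + ‖q‖ ^ 2))
        (‖p‖ ^ 2 - inner ℝ p q ^ 2 / (1 + ‖q‖ ^ 2)).toNNReal with hμ₂
  have hfin : IsFiniteMeasure ((stdGaussian E).withDensity
      fun z => ENNReal.ofReal (gaussianPDFReal 0 1 (c + inner ℝ q z))) := by
    refine isFiniteMeasure_withDensity_ofReal ?_
    refine HasFiniteIntegral.of_bounded (C := (√(2 * Real.pi))⁻¹)
      (Filter.Eventually.of_forall fun z => ?_)
    rw [Real.norm_of_nonneg (gaussianPDFReal_nonneg _ _ _), gaussianPDFReal_def]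
    simp only [NNReal.coe_one, mul_one, sub_zero]
    refine mul_le_of_le_one_right (by positivity) (Real.exp_le_one_iff.2 ?_)
    exact div_nonpos_of_nonpos_of_nonneg (by nlinarith [sq_nonneg (c + inner ℝ q z)]) (by norm_num)
  have hfin₂ : IsFiniteMeasure μ₂ := Measure.smul_finite _ ENNReal.ofReal_ne_top
  have key : μ₁ = μ₂ := by
    refine Measure.ext_of_charFun (funext fun u => ?_)
    rw [charFun_apply_real, charFun_apply_real, integral_map (by fun_prop) (by fun_prop),
      integral_withDensity_eq_integral_toReal_smul hd (by simp), hμ₂, integral_smul_measure,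
      ← charFun_apply_real, charFun_gaussianReal]
    simp only [ENNReal.toReal_ofReal (gaussianPDFReal_nonneg _ _ _), Complex.real_smul,
      ENNReal.toReal_ofReal hK0]
    rw [integral_exp_mul_gaussianPDFReal, integral_exp_mul_exp_gaussianReal, ← mul_assoc,
      ← Complex.ofReal_mul, Real.coe_toNNReal _ hv]
  have hl : ∫⁻ x, h x ∂μ₁ = ∫⁻ z, h (inner ℝ p z) *
      ENNReal.ofReal (gaussianPDFReal 0 1 (c + inner ℝ q z)) ∂stdGaussian E := by
    rw [lintegral_map hh (by fun_prop), lintegral_withDensity_eq_lintegral_mul _ hd (by fun_prop)]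
    simp [mul_comm]
  rw [← hl, key, hμ₂, lintegral_smul_measure, smul_eq_mul]

end Gaussian

/-! ### The first absolute moment of a normal variable -/

lemma gaussianPDFReal_zero_one (x : ℝ) :
    gaussianPDFReal 0 1 x = (√(2 * Real.pi))⁻¹ * Real.exp (-(1 / 2) * x ^ 2) := by
  rw [gaussianPDFReal_def]
  simp
  left
  ring

lemma hasDerivAt_gaussianPDFReal (x : ℝ) :
    HasDerivAt (gaussianPDFReal 0 1) (-x * gaussianPDFReal 0 1 x) x := by
  have h : HasDerivAt (fun x : ℝ => (√(2 * Real.pi))⁻¹ * Real.exp (-(1 / 2) * x ^ 2))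
      ((√(2 * Real.pi))⁻¹ * (Real.exp (-(1 / 2) * x ^ 2) * (-(1 / 2) * (2 * x)))) x := by
    have h0 := ((hasDerivAt_pow 2 x).const_mul (-(1 / 2) : ℝ)).exp.const_mul (√(2 * Real.pi))⁻¹
    simpa using h0
  rw [show gaussianPDFReal 0 1 = fun x : ℝ => (√(2 * Real.pi))⁻¹ * Real.exp (-(1 / 2) * x ^ 2)
    from funext gaussianPDFReal_zero_one]
  convert h using 1
  ring

lemma tendsto_gaussianPDFReal_cocompact :
    Filter.Tendsto (gaussianPDFReal 0 1) (Filter.cocompact ℝ) (nhds 0) := by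
  have h := tendsto_rpow_abs_mul_exp_neg_mul_sq_cocompact (a := 1 / 2) (by norm_num) 0
  have h2 := h.const_mul (√(2 * Real.pi))⁻¹
  simp only [Real.rpow_zero, one_mul, mul_zero] at h2
  exact h2.congr fun x => (gaussianPDFReal_zero_one x).symm

lemma gaussianPDFReal_neg (x : ℝ) : gaussianPDFReal 0 1 (-x) = gaussianPDFReal 0 1 x := by
  simp [gaussianPDFReal_zero_one]

lemma integral_gaussianPDFReal_eq_erf (q : ℝ) :
    2 * ∫ x in (0 : ℝ)..q, gaussianPDFReal 0 1 x = erf (q / √2) := by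
  have h2 : (√2 : ℝ) ≠ 0 := by positivity
  have h := intervalIntegral.integral_comp_div (a := 0) (b := q)
    (fun u : ℝ => Real.exp (-u ^ 2)) h2
  simp_rw [gaussianPDFReal_zero_one]
  rw [intervalIntegral.integral_const_mul]
  have h3 : ∀ x : ℝ, Real.exp (-(1 / 2) * x ^ 2) = Real.exp (-(x / √2) ^ 2) := by
    intro x
    rw [div_pow, Real.sq_sqrt (by norm_num)]
    ring_nf
  simp_rw [h3]
  rw [h, erf, zero_div, Real.sqrt_mul (by norm_num), smul_eq_mul]
  have hpi : √Real.pi ≠ 0 := by positivity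
  field_simp

lemma integrable_add_mul_gaussianPDFReal (q : ℝ) :
    Integrable fun x : ℝ => (q + x) * gaussianPDFReal 0 1 x := by
  have h1 : Integrable fun x : ℝ => x * gaussianPDFReal 0 1 x := by
    have := (integrable_mul_exp_neg_mul_sq (b := 1 / 2) (by norm_num)).const_mul
      (√(2 * Real.pi))⁻¹
    refine this.congr (Filter.Eventually.of_forall fun x => ?_)
    simp only [gaussianPDFReal_zero_one]
    ring
  refine (((integrable_gaussianPDFReal 0 1).const_mul q).add h1).congr
    (Filter.Eventually.of_forall fun x => ?_)
  simp only [Pi.add_apply]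
  ring

/-- The first absolute moment of a normal variable of mean `q` and variance `1`. -/
lemma integral_abs_add_mul_gaussianPDFReal (q : ℝ) :
    ∫ x, |q + x| * gaussianPDFReal 0 1 x =
      2 * gaussianPDFReal 0 1 q + q * erf (q / √2) := by
  set φ : ℝ → ℝ := gaussianPDFReal 0 1 with hφ
  have hφc : Continuous φ := continuous_iff_continuousAt.2 fun x =>
    (hasDerivAt_gaussianPDFReal x).continuousAt
  have hφi : Integrable φ := integrable_gaussianPDFReal 0 1
  set L : ℝ := ∫ x in Set.Ioi (0 : ℝ), φ x with hL
  -- An antiderivative of `(q + x) φ x`, because `φ' = -x φ`. Splitting at the sign change `x = -q`,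
  -- the limits `± q L` cancel and the integral is `-2 G (-q)`, so the value of `L` is not needed.
  let G : ℝ → ℝ := fun x => -φ x + q * ∫ u in (0 : ℝ)..x, φ u
  have hG : ∀ x, HasDerivAt G ((q + x) * φ x) x := by
    intro x
    have h1 := (hasDerivAt_gaussianPDFReal x).neg
    have h2 := (intervalIntegral.integral_hasDerivAt_right (hφc.intervalIntegrable 0 x)
      hφc.stronglyMeasurable.stronglyMeasurableAtFilter hφc.continuousAt).const_mul q
    refine (h1.add h2).congr_deriv ?_
    rw [hφ]
    ring
  have hodd : ∀ x, ∫ u in (0 : ℝ)..(-x), φ u = -∫ u in (0 : ℝ)..x, φ u := by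
    intro x
    have h := intervalIntegral.integral_comp_neg (a := 0) (b := -x) φ
    simp only [hφ, gaussianPDFReal_neg, neg_neg, neg_zero] at h ⊢
    rw [h, intervalIntegral.integral_symm]
  have htop : Filter.Tendsto (fun x => ∫ u in (0 : ℝ)..x, φ u) Filter.atTop (nhds L) :=
    intervalIntegral_tendsto_integral_Ioi 0 hφi.integrableOn Filter.tendsto_id
  have hbot : Filter.Tendsto (fun x => ∫ u in (0 : ℝ)..x, φ u) Filter.atBot (nhds (-L)) := by
    have := (htop.comp Filter.tendsto_neg_atBot_atTop).neg
    refine this.congr fun x => ?_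
    simp only [Function.comp, hodd, neg_neg]
  have hφtop : Filter.Tendsto φ Filter.atTop (nhds 0) :=
    tendsto_gaussianPDFReal_cocompact.mono_left atTop_le_cocompact
  have hφbot : Filter.Tendsto φ Filter.atBot (nhds 0) :=
    tendsto_gaussianPDFReal_cocompact.mono_left atBot_le_cocompact
  have hGtop : Filter.Tendsto G Filter.atTop (nhds (q * L)) := by
    simpa using hφtop.neg.add (htop.const_mul q)
  have hGbot : Filter.Tendsto G Filter.atBot (nhds (-(q * L))) := by
    simpa using hφbot.neg.add (hbot.const_mul q)
  have hint := integrable_add_mul_gaussianPDFReal q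
  have hI := integral_Ioi_of_hasDerivAt_of_tendsto' (a := -q) (fun x _ => hG x)
    hint.integrableOn hGtop
  have hJ := integral_Iic_of_hasDerivAt_of_tendsto' (a := -q) (fun x _ => hG x)
    hint.integrableOn hGbot
  have habs : Integrable fun x : ℝ => |q + x| * φ x := by
    refine hint.abs.congr (Filter.Eventually.of_forall fun x => ?_)
    simp only [abs_mul]
    rw [abs_of_nonneg (gaussianPDFReal_nonneg 0 1 x)]
  rw [← intervalIntegral.integral_Iic_add_Ioi (b := -q) habs.integrableOn habs.integrableOn,
    setIntegral_congr_fun (g := fun x => -((q + x) * φ x)) measurableSet_Iic (fun x hx => by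
      have : q + x ≤ 0 := by have := Set.mem_Iic.1 hx; linarith
      simp only [abs_of_nonpos this]; ring),
    setIntegral_congr_fun (g := fun x => (q + x) * φ x) measurableSet_Ioi (fun x hx => by
      have : 0 ≤ q + x := by have := Set.mem_Ioi.1 hx; linarith
      simp only [abs_of_nonneg this]),
    integral_neg, hI, hJ]
  simp only [G, hodd, ← integral_gaussianPDFReal_eq_erf]
  have : φ (-q) = φ q := gaussianPDFReal_neg q
  rw [this]
  ring

lemma lintegral_abs_add_gaussianReal (q : ℝ) :
    ∫⁻ x, ENNReal.ofReal |q + x| ∂gaussianReal 0 1 =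
      ENNReal.ofReal (2 * gaussianPDFReal 0 1 q + q * erf (q / √2)) := by
  have habs : Integrable fun x : ℝ => |q + x| * gaussianPDFReal 0 1 x := by
    refine (integrable_add_mul_gaussianPDFReal q).abs.congr (Filter.Eventually.of_forall fun x => ?_)
    simp only [abs_mul]
    rw [abs_of_nonneg (gaussianPDFReal_nonneg 0 1 x)]
  rw [← integral_abs_add_mul_gaussianPDFReal, ofReal_integral_eq_lintegral_ofReal habs
    (Filter.Eventually.of_forall fun x => mul_nonneg (abs_nonneg _)
      (gaussianPDFReal_nonneg 0 1 x)), gaussianReal_of_var_ne_zero _ one_ne_zero,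
    lintegral_withDensity_eq_lintegral_mul _ (measurable_gaussianPDF _ _) (by fun_prop)]
  refine lintegral_congr fun x => ?_
  rw [Pi.mul_apply, gaussianPDF, mul_comm, ENNReal.ofReal_mul (abs_nonneg _)]

/-- The density of roots, as a function of `‖γ'‖`, `m₀` and `m₀'`. -/
noncomputable def densityOfSpeed (s x y : ℝ) : ℝ :=
  if s = 0 then 1 / Real.pi * (Real.exp (-(1 / 2) * x ^ 2) * (√(Real.pi / 2) * |y|))
  else densityFormula s x (y / s)

/-- The first absolute moment of a normal variable of mean `y` and standard deviation `s`,
weighted by the standard Gaussian density at `x`. -/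
theorem ofReal_pdf_mul_lintegral_abs {s : ℝ} (hs : 0 ≤ s) (x y : ℝ) :
    ENNReal.ofReal (gaussianPDFReal 0 1 x) *
      ∫⁻ r, ENNReal.ofReal |r| ∂gaussianReal y (s ^ 2).toNNReal =
      ENNReal.ofReal (densityOfSpeed s x y) := by
  have hpi : √Real.pi * √Real.pi = Real.pi := Real.mul_self_sqrt Real.pi_pos.le
  have h22 : (√2 : ℝ) * √2 = 2 := Real.mul_self_sqrt (by norm_num)
  have hpi0 : √Real.pi ≠ 0 := by positivity
  -- For `s = 0` the normal law is a point mass at `y`, with absolute moment `|y|`: this is the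
  -- value assigned to the density where `γ' = 0`.
  rcases hs.eq_or_lt with rfl | hs
  · rw [densityOfSpeed, if_pos rfl, zero_pow two_ne_zero, Real.toNNReal_zero,
      gaussianReal_zero_var, lintegral_dirac' _ (by fun_prop),
      ← ENNReal.ofReal_mul (gaussianPDFReal_nonneg _ _ _), gaussianPDFReal_zero_one]
    congr 1
    rw [Real.sqrt_mul (by norm_num), Real.sqrt_div Real.pi_pos.le]
    field_simp
    linear_combination (-|y|) * hpi
  · have hmap : gaussianReal y (s ^ 2).toNNReal =
        (gaussianReal 0 1).map (fun r => s * (y / s + r)) := by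
      have h1 : (fun r => s * (y / s + r)) = (fun r => y + r) ∘ (fun r => s * r) := by
        ext r; simp only [Function.comp]; field_simp
      rw [h1, ← Measure.map_map (by fun_prop) (by fun_prop), gaussianReal_map_const_mul,
        gaussianReal_map_const_add]
      congr 1
      · simp
      · ext; simp [sq_nonneg s]
    rw [hmap, lintegral_map (by fun_prop) (by fun_prop)]
    simp_rw [abs_mul, abs_of_pos hs, ENNReal.ofReal_mul hs.le]
    rw [lintegral_const_mul _ (by fun_prop), lintegral_abs_add_gaussianReal,
      ← ENNReal.ofReal_mul hs.le, ← ENNReal.ofReal_mul (gaussianPDFReal_nonneg _ _ _),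
      densityOfSpeed, if_neg hs.ne', densityFormula, gaussianPDFReal_zero_one,
      gaussianPDFReal_zero_one]
    congr 1
    generalize erf (y / s / √2) = e
    generalize Real.exp (-(1 / 2) * x ^ 2) = X
    generalize Real.exp (-(1 / 2) * (y / s) ^ 2) = Y
    rw [Real.sqrt_mul (by norm_num), Real.sqrt_div Real.pi_pos.le]
    have h1 : (√2 * √Real.pi)⁻¹ = √Real.pi / √2 * Real.pi⁻¹ := by
      have := Real.pi_pos.ne'
      field_simp
      linear_combination (-1 : ℝ) * hpi
    have h2 : (√2 * √Real.pi)⁻¹ * (√2 * √Real.pi)⁻¹ * 2 = Real.pi⁻¹ := by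
      rw [← mul_inv, show (√2 * √Real.pi) * (√2 * √Real.pi) = 2 * Real.pi by
        linear_combination √2 * √2 * hpi + Real.pi * h22]
      have := Real.pi_pos.ne'
      field_simp
    linear_combination X * s * Y * h2 + X * s * (y / s) * e * h1

/-! ### Roots on a set where the curve stays off a hyperplane -/

section Chart

variable {E : Type*} [NormedAddCommGroup E] [InnerProductSpace ℝ E] [FiniteDimensional ℝ E]
  [MeasurableSpace E] [BorelSpace E]

lemma gaussianReal_abs_moment_div (y w : ℝ) {k : ℝ} (hk : k ≠ 0) :
    ∫⁻ r, ENNReal.ofReal |r| ∂gaussianReal (-(y / k)) (w ^ 2 / k ^ 2).toNNReal =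
      ENNReal.ofReal |k|⁻¹ * ∫⁻ r, ENNReal.ofReal |r| ∂gaussianReal y (w ^ 2).toNNReal := by
  have hmap : gaussianReal (-(y / k)) (w ^ 2 / k ^ 2).toNNReal =
      (gaussianReal y (w ^ 2).toNNReal).map (fun r => -k⁻¹ * r) := by
    rw [gaussianReal_map_const_mul]
    congr 1
    · ring
    · ext
      rw [Real.coe_toNNReal _ (by positivity)]
      simp only [NNReal.coe_mul, NNReal.coe_mk, Real.coe_toNNReal _ (sq_nonneg w)]
      ring
  rw [hmap, lintegral_map (by fun_prop) (by fun_prop), ← lintegral_const_mul _ (by fun_prop)]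
  refine lintegral_congr fun r => ?_
  rw [← ENNReal.ofReal_mul (by positivity), abs_mul, abs_neg, abs_inv]

/-- The contribution of a curve `v` on the unit sphere with velocity `v'`, seen in the chart given
by solving the equation `x + ⟪v, z⟫ = 0` for the component of `z` in the direction `e`. -/
lemma lintegral_chart {e v v' : E} (he : ‖e‖ = 1) (hv : ‖v‖ = 1) (hvv' : inner ℝ v v' = 0)
    (hev : inner ℝ e v ≠ 0) (x y : ℝ) :
    ∫⁻ z, ENNReal.ofReal |-((y + inner ℝ v' (z - inner ℝ e z • e)) * inner ℝ e v -
        (x + inner ℝ v (z - inner ℝ e z • e)) * inner ℝ e v') / inner ℝ e v ^ 2| *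
      ENNReal.ofReal (gaussianPDFReal 0 1
        (-(x + inner ℝ v (z - inner ℝ e z • e)) / inner ℝ e v)) ∂stdGaussian E =
      ENNReal.ofReal (densityOfSpeed ‖v'‖ x y) := by
  set k := inner ℝ e v with hk
  set l := inner ℝ e v' with hl
  have hee : inner ℝ e e = (1 : ℝ) := by rw [real_inner_self_eq_norm_sq, he, one_pow]
  have hvv : inner ℝ v v = (1 : ℝ) := by rw [real_inner_self_eq_norm_sq, hv, one_pow]
  have hvk : inner ℝ v e = k := real_inner_comm _ _
  have hvl : inner ℝ v' e = l := real_inner_comm _ _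
  have hv'v : inner ℝ v' v = (0 : ℝ) := by rw [real_inner_comm]; exact hvv'
  have hv'v' : inner ℝ v' v' = ‖v'‖ ^ 2 := real_inner_self_eq_norm_sq v'
  -- As affine functions of `z`, the solution for the `e`-component is `c + ⟪q, z⟫` and its time
  -- derivative is `α + ⟪p, z⟫`.
  set q : E := -k⁻¹ • (v - k • e) with hq
  set p : E := -k⁻¹ • (v' - l • e) + (l / k ^ 2) • (v - k • e) with hp
  set c : ℝ := -x / k with hc
  set α : ℝ := -(y * k - x * l) / k ^ 2 with hα
  have h1 : ∀ z : E, -((y + inner ℝ v' (z - inner ℝ e z • e)) * k -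
      (x + inner ℝ v (z - inner ℝ e z • e)) * l) / k ^ 2 = α + inner ℝ p z := by
    intro z
    simp only [hp, hα, inner_add_left, inner_sub_left, inner_smul_left, inner_sub_right,
      inner_smul_right, RCLike.conj_to_real, hvk, hvl]
    field_simp
    ring
  have h2 : ∀ z : E, -(x + inner ℝ v (z - inner ℝ e z • e)) / k = c + inner ℝ q z := by
    intro z
    simp only [hq, hc, inner_sub_left, inner_smul_left, inner_sub_right,
      inner_smul_right, RCLike.conj_to_real, hvk]
    field_simp
    ring
  have hqq : 1 + ‖q‖ ^ 2 = 1 / k ^ 2 := by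
    rw [← real_inner_self_eq_norm_sq]
    simp only [hq, inner_sub_left, inner_smul_left, inner_sub_right,
      inner_smul_right, RCLike.conj_to_real, hvk, hee, hvv, ← hk]
    field_simp
    ring
  have hpq : inner ℝ p q = -l / k ^ 3 := by
    simp only [hp, hq, inner_add_left, inner_sub_left, inner_smul_left, inner_sub_right,
      inner_smul_right, RCLike.conj_to_real, hvk, hvl, hee, hvv, hv'v, ← hk]
    field_simp
    ring
  have hpp : ‖p‖ ^ 2 = ‖v'‖ ^ 2 / k ^ 2 + l ^ 2 / k ^ 4 := by
    rw [← real_inner_self_eq_norm_sq]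
    simp only [hp, inner_add_left, inner_sub_left, inner_smul_left, inner_add_right,
      inner_sub_right, inner_smul_right, RCLike.conj_to_real, hvk, hvl, hee, hvv, hv'v, hvv', hv'v',
      ← hk, ← hl]
    field_simp
    ring
  simp_rw [h1, h2]
  rw [lintegral_mul_gaussianPDFReal p q c (h := fun r => ENNReal.ofReal |α + r|) (by fun_prop),
    hqq, hpq, hpp]
  -- Under the tilt, `l = ⟪e, v'⟫` cancels from both mean and variance. The remaining `k` disappears
  -- too: `|k|⁻¹` from rescaling the moment meets `|k|` from the normalisation of the tilt.
  have hmean : α + -c * (-l / k ^ 3) / (1 / k ^ 2) = -(y / k) := by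
    rw [hα, hc]; field_simp; ring
  have hvar : ‖v'‖ ^ 2 / k ^ 2 + l ^ 2 / k ^ 4 - (-l / k ^ 3) ^ 2 / (1 / k ^ 2) =
      ‖v'‖ ^ 2 / k ^ 2 := by field_simp; ring
  have hmap : ∀ (M : ℝ) (V : NNReal), ∫⁻ r, ENNReal.ofReal |α + r| ∂gaussianReal M V =
      ∫⁻ r, ENNReal.ofReal |r| ∂gaussianReal (M + α) V := by
    intro M V
    rw [← gaussianReal_map_const_add, lintegral_map (by fun_prop) (by fun_prop)]
  rw [hmap, add_comm _ α, hmean, hvar, gaussianReal_abs_moment_div y _ hev, ← mul_assoc,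
    ← ENNReal.ofReal_mul (by positivity), ← ofReal_pdf_mul_lintegral_abs (norm_nonneg _) x y,
    gaussianPDFReal_zero_one]
  congr 2
  have hs : (√(1 / k ^ 2))⁻¹ = |k| := by
    rw [one_div, Real.sqrt_inv, inv_inv, Real.sqrt_sq_eq_abs]
  have hexp : -c ^ 2 / (2 * (1 / k ^ 2)) = -(1 / 2) * x ^ 2 := by
    rw [hc]; field_simp
  have hk0 : |k| ≠ 0 := abs_ne_zero.2 hev
  rw [hs, hexp]
  field_simp

/-- The expected number of roots on a set where the curve stays off a hyperplane. -/
lemma lintegral_encard_zeros_of_inner_ne_zero {B : Set ℝ} (hB : MeasurableSet B)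
    {γ γ' : ℝ → E} {x x' : ℝ → ℝ} (hγm : Measurable γ) (hxm : Measurable x)
    (hγ'm : Measurable γ') (hx'm : Measurable x')
    (hγ : ∀ t ∈ B, HasDerivWithinAt γ (γ' t) B t) (hx : ∀ t ∈ B, HasDerivWithinAt x (x' t) B t)
    (hunit : ∀ t ∈ B, ‖γ t‖ = 1) (horth : ∀ t ∈ B, inner ℝ (γ t) (γ' t) = 0)
    {e : E} (he : ‖e‖ = 1) (hne : ∀ t ∈ B, inner ℝ e (γ t) ≠ 0)
    (hN : Measurable fun z : E =>
      (({t ∈ B | x t + inner ℝ (γ t) z = 0}.encard : ℕ∞) : ℝ≥0∞)) :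
    ∫⁻ z, (({t ∈ B | x t + inner ℝ (γ t) z = 0}.encard : ℕ∞) : ℝ≥0∞) ∂stdGaussian E =
      ∫⁻ t in B, ENNReal.ofReal (densityOfSpeed ‖γ' t‖ (x t) (x' t)) := by
  have hRm : Measurable (fun y : E × ℝ => y.1 - inner ℝ e y.1 • e + y.2 • e) := by fun_prop
  have hfiber : ∀ z : E, ∫⁻ s, (({t ∈ B | x t + inner ℝ (γ t)
      (z - inner ℝ e z • e + s • e) = 0}.encard : ℕ∞) : ℝ≥0∞) ∂gaussianReal 0 1 =
      ∫⁻ t in B, ENNReal.ofReal |-((x' t + inner ℝ (γ' t) (z - inner ℝ e z • e)) * inner ℝ e (γ t) -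
        (x t + inner ℝ (γ t) (z - inner ℝ e z • e)) * inner ℝ e (γ' t)) / inner ℝ e (γ t) ^ 2| *
      ENNReal.ofReal (gaussianPDFReal 0 1
        (-(x t + inner ℝ (γ t) (z - inner ℝ e z • e)) / inner ℝ e (γ t))) := by
    intro z
    set r : E := z - inner ℝ e z • e
    have hNs : Measurable fun s : ℝ =>
        (({t ∈ B | x t + inner ℝ (γ t) (r + s • e) = 0}.encard : ℕ∞) : ℝ≥0∞) :=
      hN.comp (by fun_prop : Measurable fun s : ℝ => r + s • e)
    rw [gaussianReal_of_var_ne_zero _ one_ne_zero, lintegral_withDensity_eq_lintegral_mul _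
      (measurable_gaussianPDF _ _) hNs]
    -- The equation is linear in `s` with nonzero coefficient `⟪e, γ t⟫`, so the zero set is a fibre
    -- of a scalar function of `t`.
    have hset : ∀ s : ℝ, {t ∈ B | x t + inner ℝ (γ t) (r + s • e) = 0} =
        {t ∈ B | -(x t + inner ℝ (γ t) r) / inner ℝ e (γ t) = s} := by
      intro s
      ext t
      simp only [Set.mem_ofPred_eq, and_congr_right_iff]
      intro ht
      have h0 := hne t ht
      rw [inner_add_right, inner_smul_right, real_inner_comm e (γ t), div_eq_iff h0]
      constructor <;> intro h <;> linarith
    rw [← lintegral_encard_fiber hB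
      (g := fun t => -(x t + inner ℝ (γ t) r) / inner ℝ e (γ t))
      (g' := fun t => -((x' t + inner ℝ (γ' t) r) * inner ℝ e (γ t) -
        (x t + inner ℝ (γ t) r) * inner ℝ e (γ' t)) / inner ℝ e (γ t) ^ 2)
      (h := fun s => ENNReal.ofReal (gaussianPDFReal 0 1 s)) ?_ (by fun_prop) (by fun_prop)]
    · refine lintegral_congr fun s => ?_
      simp only [Pi.mul_apply]
      rw [hset, mul_comm]
      rfl
    · intro t ht
      have h1 : HasDerivWithinAt (fun t => inner ℝ (γ t) r) (inner ℝ (γ' t) r) B t := by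
        simpa using (hγ t ht).inner ℝ (hasDerivWithinAt_const t B r)
      have h2 : HasDerivWithinAt (fun t => inner ℝ e (γ t)) (inner ℝ e (γ' t)) B t := by
        simpa using (hasDerivWithinAt_const t B e).inner ℝ (hγ t ht)
      refine ((((hx t ht).add h1).neg).div h2 (hne t ht)).congr_deriv ?_
      simp only [Pi.neg_apply, Pi.add_apply]
      ring
  have hNR : Measurable fun y : E × ℝ => (({t ∈ B | x t + inner ℝ (γ t)
      (y.1 - inner ℝ e y.1 • e + y.2 • e) = 0}.encard : ℕ∞) : ℝ≥0∞) := hN.comp hRm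
  rw [← map_resample_stdGaussian he, lintegral_map hN hRm, lintegral_prod _ hNR.aemeasurable]
  simp_rw [hfiber]
  rw [lintegral_lintegral_swap]
  · exact setLIntegral_congr_fun hB fun t ht =>
      lintegral_chart he (hunit t ht) (horth t ht) (hne t ht) (x t) (x' t)
  · have h1 : Measurable fun y : E × ℝ => γ y.2 := hγm.comp measurable_snd
    have h2 : Measurable fun y : E × ℝ => γ' y.2 := hγ'm.comp measurable_snd
    have h3 : Measurable fun y : E × ℝ => x y.2 := hxm.comp measurable_snd
    have h4 : Measurable fun y : E × ℝ => x' y.2 := hx'm.comp measurable_snd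
    refine Measurable.aemeasurable ?_
    simp only [Function.uncurry_def]
    fun_prop

end Chart

/-! ### Assembling the pieces of an interval -/

section Interval

variable {E : Type*} [NormedAddCommGroup E] [InnerProductSpace ℝ E] [FiniteDimensional ℝ E]
  [MeasurableSpace E] [BorelSpace E]

lemma expected_zeros_of_continuous {a b : ℝ} {γ γ' : ℝ → E} {x x' : ℝ → ℝ}
    (hγc : Continuous γ) (hxc : Continuous x) (hγ'm : Measurable γ') (hx'm : Measurable x')
    (hγ : ∀ t ∈ Set.Icc a b, HasDerivWithinAt γ (γ' t) (Set.Icc a b) t)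
    (hx : ∀ t ∈ Set.Icc a b, HasDerivWithinAt x (x' t) (Set.Icc a b) t)
    (hunit : ∀ t ∈ Set.Icc a b, ‖γ t‖ = 1)
    (horth : ∀ t ∈ Set.Icc a b, inner ℝ (γ t) (γ' t) = 0) :
    Measurable (fun z : E =>
      (({t ∈ Set.Icc a b | x t + inner ℝ (γ t) z = 0}.encard : ℕ∞) : ℝ≥0∞)) ∧
    ∫⁻ z, (({t ∈ Set.Icc a b | x t + inner ℝ (γ t) z = 0}.encard : ℕ∞) : ℝ≥0∞) ∂stdGaussian E =
      ∫⁻ t in Set.Icc a b, ENNReal.ofReal (densityOfSpeed ‖γ' t‖ (x t) (x' t)) := by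
  let β := stdOrthonormalBasis ℝ E
  -- The pieces sort `t` by the first basis vector not orthogonal to `γ t`, which exists as `γ t ≠
  -- 0`. Bounding that coordinate below by `1 / (k + 1)` exhibits each piece as a countable union of
  -- compact sets, as measurability of the count requires.
  let K : Fin (Module.finrank ℝ E) → ℕ → Set ℝ := fun j k =>
    Set.Icc a b ∩ ({t | ∀ i < j, inner ℝ (β i) (γ t) = 0} ∩
      {t | 1 / ((k : ℝ) + 1) ≤ |inner ℝ (β j) (γ t)|})
  have hK : ∀ j k, IsCompact (K j k) := by
    intro j k
    refine isCompact_Icc.inter_right (IsClosed.inter ?_ ?_)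
    · simp only [Set.ofPred_forall]
      exact isClosed_iInter fun i => isClosed_iInter fun _ =>
        isClosed_eq (by fun_prop) continuous_const
    · exact isClosed_le continuous_const (by fun_prop)
  let B : Fin (Module.finrank ℝ E) → Set ℝ := fun j => ⋃ k, K j k
  have hmem : ∀ j t, t ∈ B j ↔ t ∈ Set.Icc a b ∧ (∀ i < j, inner ℝ (β i) (γ t) = 0) ∧
      inner ℝ (β j) (γ t) ≠ 0 := by
    intro j t
    simp only [B, K, Set.mem_iUnion, Set.mem_inter_iff, Set.mem_ofPred_eq]
    constructor
    · rintro ⟨k, h1, h2, h3⟩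
      refine ⟨h1, h2, abs_pos.1 (lt_of_lt_of_le (by positivity) h3)⟩
    · rintro ⟨h1, h2, h3⟩
      obtain ⟨k, hk⟩ := exists_nat_one_div_lt (abs_pos.2 h3)
      exact ⟨k, h1, h2, hk.le⟩
  have hBm : ∀ j, MeasurableSet (B j) := fun j =>
    MeasurableSet.iUnion fun k => (hK j k).measurableSet
  have hBd : Pairwise (Function.onFun Disjoint B) := by
    intro i j hij
    refine Set.disjoint_left.2 fun t hi hj => ?_
    rw [hmem] at hi hj
    rcases lt_or_gt_of_ne hij with h | h
    · exact hi.2.2 (hj.2.1 i h)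
    · exact hj.2.2 (hi.2.1 j h)
  have hBsub : ∀ j, B j ⊆ Set.Icc a b := fun j t ht => ((hmem j t).1 ht).1
  have hBU : Set.Icc a b = ⋃ j, B j := by
    refine Set.Subset.antisymm (fun t ht => ?_) (Set.iUnion_subset hBsub)
    have h0 : ∃ i, inner ℝ (β i) (γ t) ≠ 0 := by
      by_contra! h
      have : γ t = 0 := by
        rw [← β.sum_repr' (γ t)]
        exact Finset.sum_eq_zero fun i _ => by rw [h i, zero_smul]
      have h1 := hunit t ht
      rw [this, norm_zero] at h1
      exact zero_ne_one h1
    let S := Finset.univ.filter fun i => inner ℝ (β i) (γ t) ≠ 0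
    have hS : S.Nonempty := by
      obtain ⟨i, hi⟩ := h0
      exact ⟨i, by simp [S, hi]⟩
    refine Set.mem_iUnion.2 ⟨S.min' hS, (hmem _ _).2 ⟨ht, fun i hi => ?_, ?_⟩⟩
    · by_contra hne
      exact absurd (S.min'_le i (by simp [S, hne])) (not_le.2 hi)
    · have := S.min'_mem hS
      simpa [S] using this
  have hF : Continuous (Function.uncurry fun (t : ℝ) (z : E) => x t + inner ℝ (γ t) z) := by
    simp only [Function.uncurry_def]
    fun_prop
  have hNm : ∀ j, Measurable fun z : E =>
      (({t ∈ B j | x t + inner ℝ (γ t) z = 0}.encard : ℕ∞) : ℝ≥0∞) := fun j =>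
    measurable_encard_zeros hF (hK j) rfl
  have hsum : ∀ z : E, (({t ∈ Set.Icc a b | x t + inner ℝ (γ t) z = 0}.encard : ℕ∞) : ℝ≥0∞) =
      ∑' j, (({t ∈ B j | x t + inner ℝ (γ t) z = 0}.encard : ℕ∞) : ℝ≥0∞) := by
    intro z
    rw [← encard_iUnion_eq_tsum]
    · congr 2
      ext t
      simp only [hBU, Set.mem_ofPred_eq, Set.mem_iUnion, exists_and_right]
    · exact fun i j hij => (hBd hij).mono (Set.sep_subset _ _) (Set.sep_subset _ _)
  simp_rw [hsum]
  refine ⟨Measurable.tsum hNm, ?_⟩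
  rw [lintegral_tsum fun j => (hNm j).aemeasurable]
  conv_rhs => rw [hBU]
  rw [lintegral_iUnion hBm hBd]
  congr 1
  ext j
  exact lintegral_encard_zeros_of_inner_ne_zero (hBm j) hγc.measurable hxc.measurable hγ'm hx'm
    (fun t ht => (hγ t (hBsub j ht)).mono (hBsub j))
    (fun t ht => (hx t (hBsub j ht)).mono (hBsub j))
    (fun t ht => hunit t (hBsub j ht)) (fun t ht => horth t (hBsub j ht))
    (β.orthonormal.1 j) (fun t ht => ((hmem j t).1 ht).2.2) (hNm j)

/-- Away from the two endpoints this is `deriv g` cut off to the open interval, the derivative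
within a set being `0` by convention outside its closure. -/
lemma measurable_derivWithin_Icc {F : Type*} [NormedAddCommGroup F] [NormedSpace ℝ F]
    [CompleteSpace F] [MeasurableSpace F] [BorelSpace F] (a b : ℝ)
    (g : ℝ → F) : Measurable (derivWithin g (Set.Icc a b)) := by
  refine measurable_of_measurable_on_compl_finite {a, b} (by simp) ?_
  have h : Measurable ((Set.Ioo a b).indicator (deriv g)) :=
    (measurable_deriv g).indicator measurableSet_Ioo
  convert h.comp measurable_subtype_coe using 1
  ext ⟨t, ht⟩
  simp only [Set.mem_compl_iff, Set.mem_insert_iff, Set.mem_singleton_iff, not_or] at ht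
  by_cases hI : t ∈ Set.Ioo a b
  · simp [hI, derivWithin_of_mem_nhds (Icc_mem_nhds hI.1 hI.2)]
  · have : t ∉ closure (Set.Icc a b) := by
      rw [isClosed_Icc.closure_eq]
      exact fun h => hI ⟨lt_of_le_of_ne h.1 (Ne.symm ht.1), lt_of_le_of_ne h.2 ht.2⟩
    simp [hI, derivWithin_zero_of_notMem_closure this]

lemma inner_derivWithin_Icc_eq_zero {E : Type*} [NormedAddCommGroup E] [InnerProductSpace ℝ E]
    {a b : ℝ} {γ : ℝ → E}
    (hγ : DifferentiableOn ℝ γ (Set.Icc a b)) (hunit : ∀ t ∈ Set.Icc a b, ‖γ t‖ = 1) {t : ℝ}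
    (ht : t ∈ Set.Icc a b) : inner ℝ (γ t) (derivWithin γ (Set.Icc a b) t) = 0 := by
  -- A one-point interval has no accumulation point, so there the derivative takes its default value
  -- `0`. Otherwise differentiate `⟪γ, γ⟫ = 1`.
  rcases (ht.1.trans ht.2).eq_or_lt with rfl | hab
  · have h0 : ¬AccPt t (Filter.principal (Set.Icc a a)) := fun h => by
      have h1 := Set.Infinite.of_accPt h
      rw [Set.Icc_self] at h1
      exact h1 (Set.finite_singleton a)
    rw [derivWithin_zero_of_not_accPt h0, inner_zero_right]
  · have h1 := (hγ t ht).hasDerivWithinAt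
    have h2 := h1.inner ℝ h1
    have h3 : HasDerivWithinAt (fun t => inner ℝ (γ t) (γ t)) (0 : ℝ) (Set.Icc a b) t :=
      (hasDerivWithinAt_const t _ (1 : ℝ)).congr
        (fun s hs => by rw [real_inner_self_eq_norm_sq, hunit s hs, one_pow])
        (by rw [real_inner_self_eq_norm_sq, hunit t ht, one_pow])
    have h4 := (uniqueDiffOn_Icc hab t ht).eq_deriv _ h2 h3
    have h5 := real_inner_comm (γ t) (derivWithin γ (Set.Icc a b) t)
    linarith

/-- The expected number of zeros of `x t + ⟪γ t, z⟫` on `[a, b]` for a standard Gaussian vector `z`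
and a differentiable curve `γ` on the unit sphere. -/
theorem expected_zeros {a b : ℝ} (hab : a ≤ b) {γ : ℝ → E} {x : ℝ → ℝ}
    (hγ : DifferentiableOn ℝ γ (Set.Icc a b)) (hx : DifferentiableOn ℝ x (Set.Icc a b))
    (hunit : ∀ t ∈ Set.Icc a b, ‖γ t‖ = 1) :
    Measurable (fun z : E =>
      (({t ∈ Set.Icc a b | x t + inner ℝ (γ t) z = 0}.encard : ℕ∞) : ℝ≥0∞)) ∧
    ∫⁻ z, (({t ∈ Set.Icc a b | x t + inner ℝ (γ t) z = 0}.encard : ℕ∞) : ℝ≥0∞) ∂stdGaussian E =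
      ∫⁻ t in Set.Icc a b, ENNReal.ofReal (densityOfSpeed ‖deriv γ t‖ (x t) (deriv x t)) := by
  -- Constant extension past the endpoints gives globally continuous functions without changing
  -- anything on `[a, b]`.
  let γe := Set.IccExtend hab ((Set.Icc a b).domRestrict γ)
  let xe := Set.IccExtend hab ((Set.Icc a b).domRestrict x)
  have hγe : ∀ t ∈ Set.Icc a b, γe t = γ t := fun t ht => Set.IccExtend_of_mem hab _ ht
  have hxe : ∀ t ∈ Set.Icc a b, xe t = x t := fun t ht => Set.IccExtend_of_mem hab _ ht
  obtain ⟨h1, h2⟩ := expected_zeros_of_continuous (a := a) (b := b) (γ := γe) (x := xe)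
    (γ' := derivWithin γ (Set.Icc a b)) (x' := derivWithin x (Set.Icc a b))
    (hγ.continuousOn.domRestrict.Icc_extend' (h := hab))
    (hx.continuousOn.domRestrict.Icc_extend' (h := hab))
    (measurable_derivWithin_Icc a b γ) (measurable_derivWithin_Icc a b x)
    (fun t ht => (hγ t ht).hasDerivWithinAt.congr hγe (hγe t ht))
    (fun t ht => (hx t ht).hasDerivWithinAt.congr hxe (hxe t ht))
    (fun t ht => by rw [hγe t ht, hunit t ht])
    (fun t ht => by rw [hγe t ht, inner_derivWithin_Icc_eq_zero hγ hunit ht])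
  have hset : ∀ z : E, {t ∈ Set.Icc a b | xe t + inner ℝ (γe t) z = 0} =
      {t ∈ Set.Icc a b | x t + inner ℝ (γ t) z = 0} := by
    intro z
    ext t
    simp only [Set.mem_ofPred_eq, and_congr_right_iff]
    intro ht
    rw [hγe t ht, hxe t ht]
  simp_rw [hset] at h1 h2
  refine ⟨h1, h2.trans ?_⟩
  -- One-sided and two-sided derivatives may differ only at the endpoints, a null set.
  rw [setLIntegral_congr Ioo_ae_eq_Icc.symm, setLIntegral_congr Ioo_ae_eq_Icc.symm]
  refine setLIntegral_congr_fun measurableSet_Ioo fun t ht => ?_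
  have hn := Icc_mem_nhds ht.1 ht.2
  simp only [hxe t (Set.Ioo_subset_Icc_self ht), derivWithin_of_mem_nhds hn]

end Interval

/-! ### Reduction to a standard Gaussian vector -/

section Main

variable {n : ℕ}

lemma sum_mul_eq_inner_curve (f : Fin (n + 1) → ℝ → ℝ) (x : EuclideanSpace ℝ (Fin (n + 1))) (t : ℝ) :
    ∑ i, x i * f i t = inner ℝ (curve f t) x := by
  simp [PiLp.inner_apply, curve]

lemma inner_toEuclideanCLM_sqrt (C : Matrix (Fin (n + 1)) (Fin (n + 1)) ℝ)
    (v z : EuclideanSpace ℝ (Fin (n + 1))) :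
    inner ℝ v (Matrix.toEuclideanCLM (𝕜 := ℝ) (CFC.sqrt C) z) =
      inner ℝ (Matrix.toEuclideanCLM (𝕜 := ℝ) (CFC.sqrt C) v) z := by
  have h : IsSelfAdjoint (CFC.sqrt C) := IsSelfAdjoint.of_nonneg (CFC.sqrt_nonneg C)
  have h2 := h.map (Matrix.toEuclideanCLM (n := Fin (n + 1)) (𝕜 := ℝ))
  exact ((ContinuousLinearMap.isSelfAdjoint_iff_isSymmetric.1 h2) v z).symm

lemma measurable_rootCount {f : Fin (n + 1) → ℝ → ℝ} {a b : ℝ} (hab : a ≤ b)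
    (hf : ∀ i, DifferentiableOn ℝ (f i) (Set.Icc a b)) : Measurable (rootCount f a b) := by
  let fe : Fin (n + 1) → ℝ → ℝ := fun i => Set.IccExtend hab ((Set.Icc a b).domRestrict (f i))
  have hfe : ∀ i, ∀ t ∈ Set.Icc a b, fe i t = f i t :=
    fun i t ht => Set.IccExtend_of_mem hab _ ht
  have hfc : ∀ i, Continuous (fe i) := fun i =>
    (hf i).continuousOn.domRestrict.Icc_extend' (h := hab)
  have hF : Continuous (Function.uncurry fun (t : ℝ) (x : EuclideanSpace ℝ (Fin (n + 1))) =>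
      ∑ i, x i * fe i t) := by
    simp only [Function.uncurry_def]
    fun_prop
  convert measurable_encard_zeros hF (K := fun _ => Set.Icc a b) (fun _ => isCompact_Icc)
    (Set.iUnion_const _).symm using 3 with x
  rw [rootCount]
  congr 2
  ext t
  simp only [Set.mem_ofPred_eq, and_congr_right_iff]
  intro ht
  simp_rw [hfe _ t ht]

/-- Self-adjointness moves `C^{1/2}` from the random vector to the curve. -/
lemma sum_add_sqrt_mul (m : EuclideanSpace ℝ (Fin (n + 1)))
    (C : Matrix (Fin (n + 1)) (Fin (n + 1)) ℝ) (f : Fin (n + 1) → ℝ → ℝ)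
    (z : EuclideanSpace ℝ (Fin (n + 1))) (t : ℝ) :
    ∑ i, (m + Matrix.toEuclideanCLM (𝕜 := ℝ) (CFC.sqrt C) z) i * f i t =
      meanFun m f t + inner ℝ (sqrtCurve C f t) z := by
  rw [sum_mul_eq_inner_curve, inner_add_right, inner_toEuclideanCLM_sqrt, meanFun,
    sum_mul_eq_inner_curve, sqrtCurve]

lemma sum_add_sqrt_mul_eq_zero_iff (m : EuclideanSpace ℝ (Fin (n + 1)))
    (C : Matrix (Fin (n + 1)) (Fin (n + 1)) ℝ) (f : Fin (n + 1) → ℝ → ℝ)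
    (z : EuclideanSpace ℝ (Fin (n + 1))) {t : ℝ} (ht : sqrtCurve C f t ≠ 0) :
    ∑ i, (m + Matrix.toEuclideanCLM (𝕜 := ℝ) (CFC.sqrt C) z) i * f i t = 0 ↔
      mZero m C f t + inner ℝ (gammaC C f t) z = 0 := by
  have h0 : ‖sqrtCurve C f t‖ ≠ 0 := norm_ne_zero_iff.2 ht
  have h : mZero m C f t + inner ℝ (gammaC C f t) z =
      (meanFun m f t + inner ℝ (sqrtCurve C f t) z) / ‖sqrtCurve C f t‖ := by
    rw [mZero, gammaC, unitCurve, inner_smul_left, RCLike.conj_to_real]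
    ring
  rw [sum_add_sqrt_mul, h, div_eq_zero_iff, or_iff_left h0]

lemma rootDensity_eq (m : EuclideanSpace ℝ (Fin (n + 1)))
    (C : Matrix (Fin (n + 1)) (Fin (n + 1)) ℝ) (f : Fin (n + 1) → ℝ → ℝ) (t : ℝ) :
    rootDensity m C f t =
      densityOfSpeed ‖deriv (gammaC C f) t‖ (mZero m C f t) (deriv (mZero m C f) t) := by
  simp only [rootDensity, densityOfSpeed, norm_eq_zero, mOne]

lemma differentiableOn_curve {f : Fin (n + 1) → ℝ → ℝ} {s : Set ℝ}
    (hf : ∀ i, DifferentiableOn ℝ (f i) s) : DifferentiableOn ℝ (curve f) s :=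
  (differentiableOn_piLp 2).2 hf

lemma differentiableOn_unitCurve {u : ℝ → EuclideanSpace ℝ (Fin (n + 1))} {s : Set ℝ}
    (hu : DifferentiableOn ℝ u s) (h0 : ∀ t ∈ s, u t ≠ 0) :
    DifferentiableOn ℝ (unitCurve u) s :=
  ((hu.norm ℝ h0).inv fun t ht => norm_ne_zero_iff.2 (h0 t ht)).smul hu

/-- The expected number of roots on an interval. -/
theorem lintegral_rootCount {Ω : Type*} [MeasurableSpace Ω] {P : Measure Ω}
    {f : Fin (n + 1) → ℝ → ℝ} {a b : ℝ} (hab : a ≤ b)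
    (hf : ∀ i, DifferentiableOn ℝ (f i) (Set.Icc a b))
    (m : EuclideanSpace ℝ (Fin (n + 1))) (C : Matrix (Fin (n + 1)) (Fin (n + 1)) ℝ)
    (hw : ∀ t ∈ Set.Icc a b, sqrtCurve C f t ≠ 0)
    {A : Ω → EuclideanSpace ℝ (Fin (n + 1))} (hA : HasLaw A (multivariateGaussian m C) P) :
    ∫⁻ ω, rootCount f a b (A ω) ∂P =
      ∫⁻ t in Set.Icc a b, ENNReal.ofReal (rootDensity m C f t) := by
  have hm := measurable_rootCount hab hf
  have hv := differentiableOn_curve hf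
  have hwd : DifferentiableOn ℝ (sqrtCurve C f) (Set.Icc a b) :=
    (Matrix.toEuclideanCLM (𝕜 := ℝ) (CFC.sqrt C)).differentiable.comp_differentiableOn hv
  have hμd : DifferentiableOn ℝ (meanFun m f) (Set.Icc a b) :=
    DifferentiableOn.fun_sum fun i _ => (hf i).const_mul _
  have hm0 : DifferentiableOn ℝ (mZero m C f) (Set.Icc a b) :=
    hμd.div (hwd.norm ℝ hw) fun t ht => norm_ne_zero_iff.2 (hw t ht)
  obtain ⟨-, h⟩ := expected_zeros hab (differentiableOn_unitCurve hwd hw) hm0 (fun t ht => by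
    rw [unitCurve, norm_smul, norm_inv, norm_norm,
      inv_mul_cancel₀ (norm_ne_zero_iff.2 (hw t ht))])
  simp_rw [rootDensity_eq]
  -- `multivariateGaussian m C` is by definition the image of `stdGaussian` under `z ↦ m + C^{1/2}
  -- z`.
  rw [← lintegral_map' hm.aemeasurable hA.aemeasurable, hA.map_eq, multivariateGaussian,
    lintegral_map hm (by fun_prop)]
  refine Eq.trans (lintegral_congr fun z => ?_) h
  rw [rootCount]
  congr 2
  ext t
  simp only [Set.mem_ofPred_eq, and_congr_right_iff]
  exact fun ht => sum_add_sqrt_mul_eq_zero_iff m C f z (hw t ht)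

lemma sqrtCurve_one (f : Fin (n + 1) → ℝ → ℝ) : sqrtCurve 1 f = curve f := by
  ext t
  simp [sqrtCurve]

lemma rootDensity_one {m : EuclideanSpace ℝ (Fin (n + 1))} {f : Fin (n + 1) → ℝ → ℝ} {t : ℝ}
    (hd : DifferentiableAt ℝ (unitCurve (curve f)) t) :
    rootDensity m 1 f t = rootDensityId m f t := by
  have hγ : gammaC 1 f = unitCurve (curve f) := by
    ext s
    rw [gammaC, sqrtCurve_one]
  have hm0 : mZero m 1 f = fun s => inner ℝ (unitCurve (curve f) s) m := by
    ext s
    rw [mZero, sqrtCurve_one, meanFun, sum_mul_eq_inner_curve, unitCurve, inner_smul_left,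
      RCLike.conj_to_real]
    ring
  have hm0' : deriv (mZero m 1 f) t = inner ℝ (deriv (unitCurve (curve f)) t) m := by
    rw [hm0, deriv_inner_apply ℝ hd (differentiableAt_const m)]
    simp
  rw [rootDensity_eq, hγ, hm0', hm0, densityOfSpeed, rootDensityId]
  -- Here `m₀' = ⟪γ', m⟫` vanishes with `γ'`, so the limiting value and the plain formula are both
  -- `0`.
  by_cases h : deriv (unitCurve (curve f)) t = 0
  · simp [h, densityFormula]
  · rw [if_neg (norm_ne_zero_iff.2 h), inner_smul_left, RCLike.conj_to_real]
    congr 1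
    ring

end Main

end RandomRoots

theorem corollary5p1 {Ω : Type*} [MeasurableSpace Ω] (P : Measure Ω) [IsProbabilityMeasure P]
    (n : ℕ) (f : Fin (n + 1) → ℝ → ℝ) (a b : ℝ) (hab : a ≤ b)
    (hf : ∀ i, DifferentiableOn ℝ (f i) (Set.Icc a b))
    (m : EuclideanSpace ℝ (Fin (n + 1)))
    (C : Matrix (Fin (n + 1)) (Fin (n + 1)) ℝ) (hC : C.PosSemidef)
    (hw : ∀ t ∈ Set.Icc a b, RandomRoots.sqrtCurve C f t ≠ 0)
    (A : Ω → EuclideanSpace ℝ (Fin (n + 1))) (hA : HasLaw A (multivariateGaussian m C) P) :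
    -- the number of roots on `[a, b]` is a random variable with the stated expectation
    (AEMeasurable (fun ω => RandomRoots.rootCount f a b (A ω)) P ∧
      ∫⁻ ω, RandomRoots.rootCount f a b (A ω) ∂P =
        ∫⁻ t in Set.Icc a b, ENNReal.ofReal (RandomRoots.rootDensity m C f t)) ∧
    -- for identity covariance, the density of the roots in terms of the components of `m`
    (C = 1 → ∀ c d : ℝ, a ≤ c → c ≤ d → d ≤ b →
      ∫⁻ ω, RandomRoots.rootCount f c d (A ω) ∂P =
        ∫⁻ t in Set.Icc c d, ENNReal.ofReal (RandomRoots.rootDensityId m f t)) := by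
  refine ⟨⟨(RandomRoots.measurable_rootCount hab hf).comp_aemeasurable hA.aemeasurable,
    RandomRoots.lintegral_rootCount hab hf m C hw hA⟩, ?_⟩
  rintro rfl c d hac hcd hdb
  have hsub : Set.Icc c d ⊆ Set.Icc a b := Set.Icc_subset_Icc hac hdb
  have hf' := fun i => (hf i).mono hsub
  rw [RandomRoots.lintegral_rootCount hcd hf' m 1 (fun t ht => hw t (hsub ht)) hA,
    setLIntegral_congr Ioo_ae_eq_Icc.symm, setLIntegral_congr Ioo_ae_eq_Icc.symm]
  refine setLIntegral_congr_fun measurableSet_Ioo fun t ht => ?_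
  have hd : DifferentiableAt ℝ (RandomRoots.unitCurve (RandomRoots.curve f)) t :=
    (RandomRoots.differentiableOn_unitCurve (RandomRoots.differentiableOn_curve hf')
      fun s hs => RandomRoots.sqrtCurve_one f ▸ hw s (hsub hs)).differentiableAt
      (Icc_mem_nhds ht.1 ht.2)
  simp only [RandomRoots.rootDensity_one hd]
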